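/- Let $n\ge 2$, let $\Omega\subset\mathbb{R}^n$ be a domain, and let $E\subset\Omega$ be closed in $\Omega$ with $\mathcal{H}^{n-1}(E)=0$, where $\mathcal{H}^{n-1}$ denotes the $(n-1)$-dimensional Hausdorff measure. Let $u:\Omega\setminus E\to\mathbb{R}$ be harmonic and such that (i) $u\in L^1_{\mathrm{loc}}(\Omega)$, and (ii) for each $1\le j\le n$, $\dfrac{\partial^2 u}{\partial x_j^2}\in L^1_{\mathrm{loc}}(\Omega)$. (Since $E$ has Lebesgue measure zero, $u$ and $\partial^2u/\partial x_j^2$, which are defined on $\Omega\setminus E$, are defined almost everywhere in $\Omega$; the second partial derivatives are the classical pointwise ones on $\Omega\setminus E$.) Then $u$ has a unique harmonic extension to $\Omega$: there is a harmonic function $v:\Omega\to\mathbb{R}$ with $v=u$ on $\Omega\setminus E$, and every harmonic function on $\Omega$ that equals $u$ on $\Omega\setminus E$ equals $v$ on $\Omega$. -/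

import Mathlib

open MeasureTheory

/-- The pure second partial derivative `∂²u/∂x_j²` of `u : ℝⁿ → ℝ` at the point `x`, that is, the
directional derivative in the direction of the `j`-th standard unit vector, taken twice. -/
noncomputable def secondPartial {n : ℕ} (j : Fin n) (u : EuclideanSpace ℝ (Fin n) → ℝ)
    (x : EuclideanSpace ℝ (Fin n)) : ℝ :=
  lineDeriv ℝ (fun y => lineDeriv ℝ u y (EuclideanSpace.single j 1)) x (EuclideanSpace.single j 1)

/-!
A function `u` that is harmonic off `E` is weakly harmonic across `E`: the projection of `E` along a
coordinate axis is a null set, so almost every line parallel to that axis misses `E`, and one can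
integrate by parts twice on these lines and conclude with Fubini.

A weakly harmonic function is a.e. equal to a harmonic one (Weyl's lemma). If `k` is a radial
profile, then `w k(w)` is the gradient of a function of `‖w‖²`, so that the derivative in `l` of the
mollifier `lᵈ k(l z)`, namely `lᵈ⁻¹ div (w k(w))` at `w = l z`, is the Laplacian of a test function.
Hence the mollifications of `u` do not depend on `l`; they are harmonic and tend to `u` a.e.
-/

open InnerProductSpace Metric Set Filter Function ContinuousLinearMap
open scoped Laplacian Topology ContDiff Convolution

section Laplacian

variable {F' : Type*} [NormedAddCommGroup F'] [NormedSpace ℝ F']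

theorem fderiv_comp_const_sub {F : Type*} [NormedAddCommGroup F] [NormedSpace ℝ F] (f : F → F')
    (a x : F) : fderiv ℝ (fun y => f (a - y)) x = -fderiv ℝ f (a - x) := by
  have h := fderiv_comp_smul (𝕜 := ℝ) (f := fun y => f (a + y)) (x := x) (-1)
  simpa [fderiv_comp_add_left, sub_eq_add_neg] using h

variable {F : Type*} [NormedAddCommGroup F] [InnerProductSpace ℝ F] [FiniteDimensional ℝ F]

theorem laplacian_eq_sum_fderiv_fderiv {ι : Type*} [Fintype ι] (b : OrthonormalBasis ι ℝ F)
    (f : F → F') (x : F) : Δ f x = ∑ i, fderiv ℝ (fderiv ℝ f) x (b i) (b i) := by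
  simp [laplacian_eq_iteratedFDeriv_orthonormalBasis f b, iteratedFDeriv_two_apply]

theorem laplacian_comp_const_sub (f : F → F') (a x : F) :
    Δ (fun y => f (a - y)) x = Δ f (a - x) := by
  simp only [laplacian_eq_sum_fderiv_fderiv (stdOrthonormalBasis ℝ F),
    funext (fderiv_comp_const_sub f a), fderiv_fun_neg, fderiv_comp_const_sub, neg_neg]

theorem support_laplacian_subset (f : F → F') : support (Δ f) ⊆ tsupport f := by
  refine support_subset_iff'.2 fun x hx => ?_
  have hzero : f =ᶠ[𝓝 x] fun _ => 0 := notMem_tsupport_iff_eventuallyEq.1 hx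
  rw [(laplacian_congr_nhds hzero).eq_of_nhds, laplacian_const, Pi.zero_apply]

theorem laplacian_comp_norm_sq {G G' G'' : ℝ → ℝ} (hG : ∀ s, HasDerivAt G (G' s) s)
    (hG' : ∀ s, HasDerivAt G' (G'' s) s) (z : F) :
    Δ (fun x : F => G (‖x‖ ^ 2)) z =
      4 * ‖z‖ ^ 2 * G'' (‖z‖ ^ 2) + 2 * Module.finrank ℝ F * G' (‖z‖ ^ 2) := by
  have hsq (x : F) : HasFDerivAt (fun x : F => ‖x‖ ^ 2) (2 • innerSL ℝ x) x :=
    (hasStrictFDerivAt_norm_sq x).hasFDerivAt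
  have hfirst : fderiv ℝ (fun x : F => G (‖x‖ ^ 2)) =
      fun x => G' (‖x‖ ^ 2) • (2 • innerSL ℝ x) :=
    funext fun x => ((hG _).comp_hasFDerivAt x (hsq x)).fderiv
  have hinner : HasFDerivAt (fun x : F => 2 • innerSL ℝ x) (2 • innerSL ℝ) z :=
    (innerSL ℝ : F →L[ℝ] F →L[ℝ] ℝ).hasFDerivAt.const_smul 2
  have hsecond (v : F) : fderiv ℝ (fderiv ℝ fun x : F => G (‖x‖ ^ 2)) z v v =
      4 * G'' (‖z‖ ^ 2) * inner ℝ z v ^ 2 + 2 * G' (‖z‖ ^ 2) * ‖v‖ ^ 2 := by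
    have hself : (innerSL ℝ : F →L[ℝ] F →L[ℝ] ℝ) v v = ‖v‖ ^ 2 := real_inner_self_eq_norm_sq v
    have h : HasFDerivAt (fun x : F => G' (‖x‖ ^ 2)) (G'' (‖z‖ ^ 2) • (2 • innerSL ℝ z)) z :=
      (hG' _).comp_hasFDerivAt z (hsq z)
    rw [hfirst, (h.fun_smul hinner).fderiv]
    simp only [add_apply, smul_apply, smulRight_apply, innerSL_apply_apply, nsmul_eq_mul,
      Nat.cast_ofNat, smul_eq_mul, hself]
    ring
  let b := stdOrthonormalBasis ℝ F
  simp only [laplacian_eq_sum_fderiv_fderiv b, hsecond, Finset.sum_add_distrib, ← Finset.mul_sum,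
    b.sum_sq_inner_left, b.norm_eq_one, one_pow, Finset.sum_const, Finset.card_univ,
    Fintype.card_fin, nsmul_eq_mul, mul_one]
  ring

end Laplacian

section Convolution

theorem hasDerivAt_convolution_right_with_param {H E E' F : Type*} [NormedAddCommGroup H]
    [NormedSpace ℝ H] [MeasurableSpace H] [BorelSpace H] {μ : Measure H} [NormedAddCommGroup E]
    [NormedSpace ℝ E] [NormedAddCommGroup E'] [NormedSpace ℝ E'] [NormedAddCommGroup F]
    [NormedSpace ℝ F] (L : E →L[ℝ] E' →L[ℝ] F) {f : H → E} {g : ℝ → H → E'} {s : Set ℝ} {k : Set H}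
    (hs : IsOpen s) (hk : IsCompact k) (hgs : ∀ p, ∀ x, p ∈ s → x ∉ k → g p x = 0)
    (hf : LocallyIntegrable f μ) (hg : ContDiffOn ℝ 1 ↿g (s ×ˢ univ)) {p : ℝ} (hp : p ∈ s) (x : H) :
    HasDerivAt (fun p => (f ⋆[L, μ] g p) x)
      ((f ⋆[L, μ] fun z => deriv (fun p => g p z) p) x) p := by
  have hsmem (z : H) : s ×ˢ (univ : Set H) ∈ 𝓝 (p, z) :=
    (hs.prod isOpen_univ).mem_nhds ⟨hp, mem_univ z⟩
  have hderiv (z : H) : fderiv ℝ ↿g (p, z) (1, 0) = deriv (fun p => g p z) p :=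
    (((hg.contDiffAt (hsmem z)).differentiableAt one_ne_zero).hasFDerivAt.comp_hasDerivAt p
      ((hasDerivAt_id p).prodMk (hasDerivAt_const p z))).deriv.symm
  have hcont : Continuous fun z => fderiv ℝ ↿g (p, z) :=
    (hg.continuousOn_fderiv_of_isOpen (hs.prod isOpen_univ) le_rfl).comp_continuous
      (.prodMk_right p) fun z => ⟨hp, mem_univ z⟩
  have hcompact : HasCompactSupport fun z => fderiv ℝ ↿g (p, z) := by
    refine .intro hk fun z hz => ?_
    have hzero : ↿g =ᶠ[𝓝 (p, z)] fun _ => 0 := by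
      filter_upwards [(hs.prod hk.isClosed.isOpen_compl).mem_nhds ⟨hp, hz⟩] with q hq
      exact hgs q.1 q.2 hq.1 hq.2
    rw [hzero.fderiv_eq, fderiv_fun_const, Pi.zero_apply]
  refine ((hasFDerivAt_convolution_right_with_param L hs hk hgs hf hg (p, x) hp).comp_hasDerivAt p
    ((hasDerivAt_id p).prodMk (hasDerivAt_const p x))).congr_deriv ?_
  simp only [← hderiv]
  exact convolution_precompR_apply L hf hcompact hcont x (1, 0)

variable {F : Type*} [NormedAddCommGroup F] [InnerProductSpace ℝ F] [FiniteDimensional ℝ F]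
  [MeasurableSpace F] [BorelSpace F] {μ : Measure F} [μ.IsAddHaarMeasure]

theorem laplacian_convolution_right {f φ : F → ℝ} (hf : LocallyIntegrable f μ)
    (hφ : ContDiff ℝ 2 φ) (hφc : HasCompactSupport φ) :
    Δ (f ⋆[lsmul ℝ ℝ, μ] φ) = f ⋆[lsmul ℝ ℝ, μ] Δ φ := by
  let b := stdOrthonormalBasis ℝ F
  have hφ₁ : ContDiff ℝ 1 (fderiv ℝ φ) := hφ.fderiv_right (by norm_num)
  have hφ₂ : Continuous (fderiv ℝ (fderiv ℝ φ)) := hφ₁.continuous_fderiv one_ne_zero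
  have hc₁ : HasCompactSupport (fderiv ℝ φ) := hφc.fderiv ℝ
  have hcv (v : F) : HasCompactSupport fun z => fderiv ℝ (fderiv ℝ φ) z v := hc₁.fderiv_apply ℝ v
  have hfirst : fderiv ℝ (f ⋆[lsmul ℝ ℝ, μ] φ) =
      f ⋆[(lsmul ℝ ℝ).precompR F, μ] fderiv ℝ φ :=
    funext fun x => (hφc.hasFDerivAt_convolution_right _ hf (hφ.of_le one_le_two) x).fderiv
  have hsecond (x v : F) : fderiv ℝ (fderiv ℝ (f ⋆[lsmul ℝ ℝ, μ] φ)) x v v =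
      (f ⋆[lsmul ℝ ℝ, μ] fun z => fderiv ℝ (fderiv ℝ φ) z v v) x := by
    rw [hfirst, (hc₁.hasFDerivAt_convolution_right _ hf hφ₁ x).fderiv,
      convolution_precompR_apply _ hf (hc₁.fderiv ℝ) hφ₂,
      convolution_precompR_apply _ hf (hcv v) (by fun_prop)]
  have hexists (x v : F) :
      ConvolutionExistsAt f (fun z => fderiv ℝ (fderiv ℝ φ) z v v) x (lsmul ℝ ℝ) μ :=
    ((hcv v).comp_left (g := fun L : F →L[ℝ] ℝ => L v) rfl).convolutionExists_right _ hf
      (by fun_prop) x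
  ext x
  simp only [laplacian_eq_sum_fderiv_fderiv b, hsecond, convolution_def, map_sum]
  exact (integral_finsetSum _ fun i _ => hexists x (b i)).symm

end Convolution

section Mollifier

theorem exists_hasDerivAt_expNegInvGlue_one_sub :
    ∃ G : ℝ → ℝ, ContDiff ℝ ∞ G ∧ (∀ s, 1 ≤ s → G s = 0) ∧
      ∀ s, HasDerivAt G (expNegInvGlue (1 - s)) s := by
  have hg : ContDiff ℝ ∞ fun s : ℝ => expNegInvGlue (1 - s) :=
    expNegInvGlue.contDiff.comp (contDiff_const.sub contDiff_id)
  have hderiv (s : ℝ) : HasDerivAt (fun s => ∫ t in (1 : ℝ)..s, expNegInvGlue (1 - t))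
      (expNegInvGlue (1 - s)) s := hg.continuous.integral_hasStrictDerivAt 1 s |>.hasDerivAt
  refine ⟨_, ?_, fun s hs => ?_, hderiv⟩
  · rw [contDiff_infty_iff_deriv, funext fun s => (hderiv s).deriv]
    exact ⟨fun s => (hderiv s).differentiableAt, hg⟩
  · refine intervalIntegral.integral_zero_ae (.of_forall fun t ht => ?_)
    rw [uIoc_of_le hs] at ht
    exact expNegInvGlue.zero_of_nonpos (sub_nonpos.2 ht.1.le)

variable {F : Type*} [NormedAddCommGroup F] [InnerProductSpace ℝ F] [MeasurableSpace F]
  {μ : Measure F} {l : ℝ} {z : F}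

/-- The standard mollifier of width `1 / l`: the bump `exp (-1 / (1 - ‖l z‖²))` on `‖z‖ < 1 / l`,
normalised to have `μ`-integral one. It is indexed by the inverse width so that it depends smoothly
on the pair `(l, z)`. -/
noncomputable def mollifier (μ : Measure F) (l : ℝ) (z : F) : ℝ :=
  (∫ x : F, expNegInvGlue (1 - ‖x‖ ^ 2) ∂μ)⁻¹ * l ^ Module.finrank ℝ F *
    expNegInvGlue (1 - l ^ 2 * ‖z‖ ^ 2)

theorem contDiff_uncurry_mollifier : ContDiff ℝ ∞ ↿(mollifier μ : ℝ → F → ℝ) :=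
  (contDiff_const.mul (contDiff_fst.pow _)).mul (expNegInvGlue.contDiff.comp
    (contDiff_const.sub ((contDiff_fst.pow 2).mul (contDiff_snd.norm_sq ℝ))))

theorem contDiff_mollifier : ContDiff ℝ ∞ (mollifier μ l : F → ℝ) :=
  contDiff_uncurry_mollifier.comp (contDiff_prodMk_right l)

theorem mollifier_nonneg (hl : 0 ≤ l) : 0 ≤ mollifier μ l z :=
  mul_nonneg (mul_nonneg (inv_nonneg.2 (integral_nonneg fun _ => expNegInvGlue.nonneg _))
    (pow_nonneg hl _)) (expNegInvGlue.nonneg _)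

theorem mollifier_eq_zero (h : 1 ≤ l * ‖z‖) : mollifier μ l z = 0 := by
  rw [mollifier, expNegInvGlue.zero_of_nonpos, mul_zero]
  rw [← mul_pow, sub_nonpos]
  exact one_le_pow₀ h

theorem mollifier_eq_pow_mul_mollifier_one :
    mollifier μ l z = l ^ Module.finrank ℝ F * mollifier μ 1 (l • z) := by
  simp only [mollifier, norm_smul, Real.norm_eq_abs, mul_pow, sq_abs, one_pow, one_mul,
    mul_one]
  ring

theorem mollifier_le_mollifier_zero (hl : 0 ≤ l) : mollifier μ l z ≤ mollifier μ l 0 := by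
  refine mul_le_mul_of_nonneg_left (expNegInvGlue.monotone ?_) (mul_nonneg
    (inv_nonneg.2 (integral_nonneg fun _ => expNegInvGlue.nonneg _)) (pow_nonneg hl _))
  simp only [norm_zero]
  nlinarith [sq_nonneg (l * ‖z‖)]

variable [FiniteDimensional ℝ F]

theorem exists_laplacian_eq_deriv_mollifier (hl : l ≠ 0) :
    ∃ φ : F → ℝ, ContDiff ℝ ∞ φ ∧ (∀ z, 1 ≤ l * ‖z‖ → φ z = 0) ∧
      ∀ z, Δ φ z = deriv (fun l => mollifier μ l z) l := by
  obtain ⟨G, hG, hG_zero, hG'⟩ := exists_hasDerivAt_expNegInvGlue_one_sub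
  set d := Module.finrank ℝ F
  set c := (∫ x : F, expNegInvGlue (1 - ‖x‖ ^ 2) ∂μ)⁻¹
  set g' : ℝ → ℝ := fun s => deriv expNegInvGlue (1 - s)
  have hg' (s : ℝ) : HasDerivAt (fun s => expNegInvGlue (1 - s)) (-g' s) s :=
    ((expNegInvGlue.contDiff (n := 1)).differentiable one_ne_zero _).hasDerivAt.comp_const_sub 1 s
  have hscale (s : ℝ) : HasDerivAt (fun s => l ^ 2 * s) (l ^ 2) s := by
    simpa using (hasDerivAt_id s).const_mul (l ^ 2)
  -- The factor for which `φ(z) = A G(‖l z‖²)` has gradient `c lᵈ⁻¹ k(l z) z`, `k(w) = G'(‖w‖²)`.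
  set A := c * l ^ d / (2 * l ^ 3)
  refine ⟨fun z => A * G (l ^ 2 * ‖z‖ ^ 2), ?_, fun z hz => ?_, fun z => ?_⟩
  · exact contDiff_const.mul (hG.comp (contDiff_const.mul (contDiff_id.norm_sq ℝ)))
  · have hle : 1 ≤ l ^ 2 * ‖z‖ ^ 2 := by simpa only [mul_pow] using one_le_pow₀ (n := 2) hz
    simp only [hG_zero _ hle, mul_zero]
  have hfirst (s : ℝ) := ((hG' (l ^ 2 * s)).comp s (hscale s)).const_mul A
  have hsecond (s : ℝ) :=
    (((hg' (l ^ 2 * s)).comp s (hscale s)).mul_const (l ^ 2)).const_mul A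
  have hparam : HasDerivAt (fun l => l ^ 2 * ‖z‖ ^ 2) (2 * l * ‖z‖ ^ 2) l := by
    simpa using (hasDerivAt_pow 2 l).mul_const (‖z‖ ^ 2)
  have hmollifier : HasDerivAt (fun l => mollifier μ l z) _ l :=
    ((hasDerivAt_pow d l).const_mul c).mul ((hg' (l ^ 2 * ‖z‖ ^ 2)).comp_of_eq l hparam rfl)
  have hpow : d * l ^ (d - 1) * l = d * l ^ d := by
    rcases d with _ | d
    · simp
    · simp only [add_tsub_cancel_right, pow_succ]
      ring
  refine (laplacian_comp_norm_sq hfirst hsecond z).trans (Eq.trans ?_ hmollifier.deriv.symm)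
  simp only [A]
  field_simp
  linear_combination (-2 * c * expNegInvGlue (1 - ‖z‖ ^ 2 * l ^ 2)) * hpow

theorem hasCompactSupport_mollifier (hl : 0 < l) : HasCompactSupport (mollifier μ l : F → ℝ) := by
  refine .intro (isCompact_closedBall 0 l⁻¹) fun z hz => mollifier_eq_zero ?_
  rw [mem_closedBall_zero_iff, not_le, inv_lt_iff_one_lt_mul₀' hl] at hz
  exact hz.le

variable [BorelSpace F] [μ.IsAddHaarMeasure]

theorem integral_mollifier (hl : 0 < l) : ∫ z : F, mollifier μ l z ∂μ = 1 := by
  have hcont : Continuous fun x : F => expNegInvGlue (1 - ‖x‖ ^ 2) :=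
    (expNegInvGlue.contDiff (n := 0)).continuous.comp (by fun_prop)
  have hcompact : HasCompactSupport fun x : F => expNegInvGlue (1 - ‖x‖ ^ 2) := by
    refine .intro (isCompact_closedBall 0 1) fun x hx => expNegInvGlue.zero_of_nonpos ?_
    rw [mem_closedBall_zero_iff, not_le] at hx
    exact sub_nonpos.2 (one_le_pow₀ hx.le)
  have hpos : 0 < ∫ x : F, expNegInvGlue (1 - ‖x‖ ^ 2) ∂μ :=
    hcont.integral_pos_of_hasCompactSupport_nonneg_nonzero hcompact
      (fun _ => expNegInvGlue.nonneg _) (x := 0) (expNegInvGlue.pos_of_pos (by simp)).ne'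
  simp_rw [mollifier_eq_pow_mul_mollifier_one (l := l), integral_const_mul]
  rw [Measure.integral_comp_smul_of_nonneg μ _ _ (hR := hl.le)]
  simp only [mollifier, one_pow, one_mul, mul_one, integral_const_mul, smul_eq_mul]
  field_simp

theorem mollifier_le_div_measureReal_closedBall (hl : 0 < l) :
    mollifier μ l z ≤ mollifier μ 1 (0 : F) * μ.real (closedBall (0 : F) 1) /
      μ.real (closedBall (0 : F) l⁻¹) := by
  have hball : μ.real (closedBall (0 : F) l⁻¹) =
      (l ^ Module.finrank ℝ F)⁻¹ * μ.real (closedBall (0 : F) 1) := by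
    rw [← inv_pow, ← Measure.addHaar_real_closedBall' μ 0 (inv_nonneg.2 hl.le)]
  have hpos : 0 < μ.real (closedBall (0 : F) 1) :=
    ENNReal.toReal_pos (measure_closedBall_pos μ 0 one_pos).ne' measure_closedBall_lt_top.ne
  refine (mollifier_le_mollifier_zero hl.le).trans_eq ?_
  rw [mollifier_eq_pow_mul_mollifier_one, smul_zero, hball]
  field_simp

theorem ae_tendsto_convolution_mollifier {f : F → ℝ} (hf : LocallyIntegrable f μ) :
    ∀ᵐ x ∂μ, Tendsto (fun l => (f ⋆[lsmul ℝ ℝ, μ] mollifier μ l) x) atTop (𝓝 (f x)) := by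
  filter_upwards [(Besicovitch.vitaliFamily μ).ae_tendsto_average_norm_sub hf] with x hx
  have hradius : Tendsto (fun l : ℝ => l⁻¹) atTop (𝓝[>] 0) := tendsto_inv_atTop_nhdsGT_zero
  have haverage := (hx.comp (Besicovitch.tendsto_filterAt μ x)).comp hradius
  simp only [convolution_def, lsmul_apply, smul_eq_mul, mul_comm (f _)]
  refine tendsto_integral_smul_of_tendsto_average_norm_sub
    (mollifier μ 1 (0 : F) * μ.real (closedBall (0 : F) 1)) haverage
    (.of_forall fun l => hf.integrableOn_isCompact (isCompact_closedBall _ _)) ?_ ?_ ?_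
  · refine tendsto_const_nhds.congr' ?_
    filter_upwards [eventually_gt_atTop 0] with l hl
    rw [integral_sub_left_eq_self (mollifier μ l) μ x, integral_mollifier hl]
  · filter_upwards [eventually_gt_atTop 0] with l hl
    refine support_subset_iff'.2 fun y hy => mollifier_eq_zero ?_
    rw [mem_closedBall', dist_eq_norm, not_le, inv_lt_iff_one_lt_mul₀' hl] at hy
    exact hy.le
  · filter_upwards [eventually_gt_atTop 0] with l hl y
    rw [abs_of_nonneg (mollifier_nonneg hl.le), Measure.addHaar_real_closedBall_center μ x]
    exact mollifier_le_div_measureReal_closedBall hl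

end Mollifier

section Harmonic

variable {F : Type*} [NormedAddCommGroup F] [InnerProductSpace ℝ F] [FiniteDimensional ℝ F]
  [MeasurableSpace F] {μ : Measure F} {u v w : F → ℝ} {Ω : Set F}

variable [μ.IsOpenPosMeasure]

theorem eqOn_of_harmonicOnNhd_of_ae_eq (hΩ : IsOpen Ω) (hv : HarmonicOnNhd v Ω)
    (hw : HarmonicOnNhd w Ω) (h : v =ᵐ[μ.restrict Ω] w) : EqOn v w Ω :=
  Measure.eqOn_open_of_ae_eq h hΩ hv.continuousOn hw.continuousOn

theorem exists_harmonicOnNhd_ae_eq_of_locally [BorelSpace F] (hΩ : IsOpen Ω)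
    (h : ∀ x ∈ Ω, ∃ U, IsOpen U ∧ x ∈ U ∧ ∃ g, HarmonicOnNhd g U ∧ g =ᵐ[μ.restrict U] u) :
    ∃ v, HarmonicOnNhd v Ω ∧ v =ᵐ[μ.restrict Ω] u := by
  choose! U hU hxU g hg hgu using h
  have hglue {x : F} (hx : x ∈ Ω) : EqOn (fun y => g y y) (g x) (Ω ∩ U x) := fun y ⟨hy, hyx⟩ => by
    have hyx_ae : g y =ᵐ[μ.restrict (U y ∩ U x)] g x :=
      ((hgu y hy).filter_mono (ae_mono (Measure.restrict_mono_set μ inter_subset_left))).trans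
        ((hgu x hx).filter_mono (ae_mono (Measure.restrict_mono_set μ inter_subset_right))).symm
    exact eqOn_of_harmonicOnNhd_of_ae_eq ((hU y hy).inter (hU x hx))
      ((hg y hy).mono inter_subset_left) ((hg x hx).mono inter_subset_right) hyx_ae ⟨hxU y hy, hyx⟩
  refine ⟨fun y => g y y, fun x hx => ?_, ?_⟩
  · refine (harmonicAt_congr_nhds ?_).2 (hg x hx x (hxU x hx))
    exact (hglue hx).eventuallyEq_of_mem ((hΩ.inter (hU x hx)).mem_nhds ⟨hx, hxU x hx⟩)
  · refine (ae_restrict_iff' hΩ.measurableSet).2 (measure_null_of_locally_null _ fun x hx => ?_)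
    have hxΩ : x ∈ Ω := (Classical.not_imp.1 hx).1
    refine ⟨_, inter_mem_nhdsWithin _ ((hU x hxΩ).mem_nhds (hxU x hxΩ)), measure_mono_null ?_
      ((ae_restrict_iff' (hU x hxΩ).measurableSet).1 (hgu x hxΩ))⟩
    exact fun y ⟨hy, hyU⟩ hgy => hy fun hyΩ => (hglue hxΩ ⟨hyΩ, hyU⟩).trans (hgy hyU)

end Harmonic

section Weyl

theorem tsupport_comp_const_sub_subset_closedBall {F : Type*} [NormedAddCommGroup F] {φ : F → ℝ}
    {r : ℝ} (hφ : ∀ z, r < ‖z‖ → φ z = 0) (x : F) :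
    tsupport (fun y => φ (x - y)) ⊆ closedBall x r := by
  refine closure_minimal (support_subset_iff'.2 fun y hy => hφ _ ?_) isClosed_closedBall
  rwa [mem_closedBall', dist_eq_norm, not_le] at hy

variable {F : Type*} [NormedAddCommGroup F] [InnerProductSpace ℝ F] [FiniteDimensional ℝ F]
  [MeasurableSpace F] {μ : Measure F} {u f : F → ℝ} {Ω : Set F}

/-- Harmonicity on `Ω` in the sense of distributions, for a locally integrable function: `u` is
`L²`-orthogonal to the Laplacians of all smooth functions with compact support in `Ω`. -/
structure IsWeaklyHarmonicOn (u : F → ℝ) (Ω : Set F) (μ : Measure F) : Prop where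
  locallyIntegrableOn : LocallyIntegrableOn u Ω μ
  integral_mul_laplacian_eq_zero : ∀ φ : F → ℝ, ContDiff ℝ ∞ φ → HasCompactSupport φ →
    tsupport φ ⊆ Ω → ∫ x, u x * Δ φ x ∂μ = 0

namespace IsWeaklyHarmonicOn

theorem convolution_laplacian_eq_zero (hf : IsWeaklyHarmonicOn f Ω μ) {φ : F → ℝ}
    (hφ : ContDiff ℝ ∞ φ) {r : ℝ} (hφr : ∀ z, r < ‖z‖ → φ z = 0) {x : F}
    (hx : closedBall x r ⊆ Ω) : (f ⋆[lsmul ℝ ℝ, μ] Δ φ) x = 0 := by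
  have hsupport := tsupport_comp_const_sub_subset_closedBall hφr x
  have h := hf.integral_mul_laplacian_eq_zero (fun y => φ (x - y))
    (hφ.comp (contDiff_const.sub contDiff_id))
    ((isCompact_closedBall x r).of_isClosed_subset (isClosed_tsupport _) hsupport)
    (hsupport.trans hx)
  simpa only [laplacian_comp_const_sub, convolution_def, lsmul_apply, smul_eq_mul] using h

variable [BorelSpace F]

theorem locallyIntegrable_indicator (hu : IsWeaklyHarmonicOn u Ω μ) {K : Set F} (hK : IsCompact K)
    (hKΩ : K ⊆ Ω) : LocallyIntegrable (K.indicator u) μ :=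
  ((hu.locallyIntegrableOn.integrableOn_compact_subset hKΩ hK).integrable_indicator
    hK.measurableSet).locallyIntegrable

theorem indicator (hu : IsWeaklyHarmonicOn u Ω μ) {K V : Set F} (hK : IsCompact K) (hKΩ : K ⊆ Ω)
    (hV : V ⊆ K) : IsWeaklyHarmonicOn (K.indicator u) V μ where
  locallyIntegrableOn := (hu.locallyIntegrable_indicator hK hKΩ).locallyIntegrableOn V
  integral_mul_laplacian_eq_zero φ hφ hφc hφV := by
    rw [← hu.integral_mul_laplacian_eq_zero φ hφ hφc (hφV.trans (hV.trans hKΩ))]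
    refine integral_congr_ae (.of_forall fun x => ?_)
    by_cases hx : x ∈ K
    · simp only [indicator_of_mem hx]
    · have : Δ φ x = 0 := notMem_support.1 fun h => hx (hV (hφV (support_laplacian_subset φ h)))
      simp only [this, mul_zero]

variable {r k l : ℝ} {x : F}

theorem hasDerivAt_convolution_mollifier (hf : IsWeaklyHarmonicOn f Ω μ)
    (hf_int : LocallyIntegrable f μ) (hr : 0 < r) (hx : closedBall x r ⊆ Ω) (hl : r⁻¹ < l) :
    HasDerivAt (fun l => (f ⋆[lsmul ℝ ℝ, μ] mollifier μ l) x) 0 l := by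
  have hwidth {l : ℝ} (hl : r⁻¹ < l) {z : F} (hz : r < ‖z‖) : 1 ≤ l * ‖z‖ := by
    rw [← inv_mul_cancel₀ hr.ne']
    gcongr
    exact (inv_pos.2 hr).le.trans hl.le
  obtain ⟨φ, hφ, hφ_zero, hφ_laplacian⟩ :=
    exists_laplacian_eq_deriv_mollifier (μ := μ) ((inv_pos.2 hr).trans hl).ne'
  have h := hasDerivAt_convolution_right_with_param (lsmul ℝ ℝ) (g := mollifier μ) isOpen_Ioi
    (isCompact_closedBall (0 : F) r) (fun l z hl hz => mollifier_eq_zero (hwidth hl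
      (by rwa [mem_closedBall_zero_iff, not_le] at hz)))
    hf_int (contDiff_uncurry_mollifier.of_le (by norm_num)).contDiffOn hl x
  rwa [← funext hφ_laplacian,
    hf.convolution_laplacian_eq_zero hφ (fun z hz => hφ_zero z (hwidth hl hz)) hx] at h

theorem convolution_mollifier_eq (hf : IsWeaklyHarmonicOn f Ω μ)
    (hf_int : LocallyIntegrable f μ) (hr : 0 < r) (hx : closedBall x r ⊆ Ω) (hk : r⁻¹ < k)
    (hl : r⁻¹ < l) :
    (f ⋆[lsmul ℝ ℝ, μ] mollifier μ k) x = (f ⋆[lsmul ℝ ℝ, μ] mollifier μ l) x := by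
  have h (l) (hl : l ∈ Ioi r⁻¹) := hf.hasDerivAt_convolution_mollifier hf_int hr hx hl
  exact isOpen_Ioi.is_const_of_deriv_eq_zero isPreconnected_Ioi
    (fun l hl => (h l hl).differentiableAt.differentiableWithinAt)
    (fun l hl => (h l hl).deriv) hk hl

variable [μ.IsAddHaarMeasure]

theorem laplacian_convolution_mollifier (hf : IsWeaklyHarmonicOn f Ω μ)
    (hf_int : LocallyIntegrable f μ) (hl : 0 < l) (hx : closedBall x l⁻¹ ⊆ Ω) :
    Δ (f ⋆[lsmul ℝ ℝ, μ] mollifier μ l) x = 0 := by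
  rw [laplacian_convolution_right hf_int (contDiff_infty.1 contDiff_mollifier 2)
    (hasCompactSupport_mollifier hl)]
  exact hf.convolution_laplacian_eq_zero contDiff_mollifier
    (fun z hz => mollifier_eq_zero ((inv_le_iff_one_le_mul₀' hl).1 hz.le)) hx

theorem exists_harmonicOnNhd_ball_ae_eq (hu : IsWeaklyHarmonicOn u Ω μ) (hr : 0 < r)
    (hx : closedBall x (r + r) ⊆ Ω) :
    ∃ g, HarmonicOnNhd g (ball x r) ∧ g =ᵐ[μ.restrict (ball x r)] u := by
  set K := closedBall x (r + r)
  have hball {y : F} (hy : y ∈ ball x r) : closedBall y r ⊆ K :=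
    closedBall_subset_closedBall' (by gcongr; exact (mem_ball.1 hy).le)
  set f := K.indicator u
  have hf : IsWeaklyHarmonicOn f K μ := hu.indicator (isCompact_closedBall _ _) hx subset_rfl
  have hf_int : LocallyIntegrable f μ :=
    hu.locallyIntegrable_indicator (isCompact_closedBall _ _) hx
  obtain ⟨l, hl⟩ := exists_gt r⁻¹
  have hl_pos : 0 < l := (inv_pos.2 hr).trans hl
  have hsmooth : ContDiff ℝ 2 (f ⋆[lsmul ℝ ℝ, μ] mollifier μ l) :=
    (hasCompactSupport_mollifier hl_pos).contDiff_convolution_right _ hf_int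
      (contDiff_infty.1 contDiff_mollifier 2)
  refine ⟨f ⋆[lsmul ℝ ℝ, μ] mollifier μ l, fun y hy => ⟨hsmooth.contDiffAt, ?_⟩, ?_⟩
  · filter_upwards [isOpen_ball.mem_nhds hy] with z hz
    exact hf.laplacian_convolution_mollifier hf_int hl_pos
      ((closedBall_subset_closedBall (inv_lt_of_inv_lt₀ hr hl).le).trans (hball hz))
  · refine (ae_restrict_iff' measurableSet_ball).2 ?_
    filter_upwards [ae_tendsto_convolution_mollifier hf_int] with y hy hyx
    rw [← show f y = u y from indicator_of_mem (hball hyx (mem_closedBall_self hr.le)) u]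
    refine tendsto_nhds_unique (tendsto_const_nhds.congr' ?_) hy
    filter_upwards [eventually_gt_atTop r⁻¹] with k hk
    exact hf.convolution_mollifier_eq hf_int hr (hball hyx) hl hk

theorem exists_harmonicOnNhd_ae_eq (hu : IsWeaklyHarmonicOn u Ω μ) (hΩ : IsOpen Ω) :
    ∃ v, HarmonicOnNhd v Ω ∧ v =ᵐ[μ.restrict Ω] u := by
  refine exists_harmonicOnNhd_ae_eq_of_locally hΩ fun x hx => ?_
  obtain ⟨R, hR, hRΩ⟩ := nhds_basis_closedBall.mem_iff.1 (hΩ.mem_nhds hx)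
  obtain ⟨g, hg⟩ := hu.exists_harmonicOnNhd_ball_ae_eq (half_pos hR) (by rwa [add_halves])
  exact ⟨_, isOpen_ball, mem_ball_self (half_pos hR), g, hg⟩

end IsWeaklyHarmonicOn

end Weyl

section Line

theorem contDiffAt_deriv_right {𝕜 F : Type*} [NontriviallyNormedField 𝕜] [NormedAddCommGroup F]
    [NormedSpace 𝕜 F] {f : 𝕜 → F} {x : 𝕜} {m n : WithTop ℕ∞} (hf : ContDiffAt 𝕜 n f x)
    (hmn : m + 1 ≤ n) : ContDiffAt 𝕜 m (deriv f) x :=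
  (hf.fderiv_right hmn).clm_apply contDiffAt_const

variable {f p : ℝ → ℝ} {t : ℝ}

theorem hasDerivAt_mul_deriv_sub_deriv_mul (hf : ContDiffAt ℝ 2 f t) (hp : ContDiffAt ℝ 2 p t) :
    HasDerivAt (fun t => f t * deriv p t - deriv f t * p t)
      (f t * deriv (deriv p) t - deriv (deriv f) t * p t) t := by
  have hderiv {g : ℝ → ℝ} (hg : ContDiffAt ℝ 2 g t) : HasDerivAt g (deriv g t) t :=
    (hg.differentiableAt two_ne_zero).hasDerivAt
  have hderiv₂ {g : ℝ → ℝ} (hg : ContDiffAt ℝ 2 g t) :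
      HasDerivAt (deriv g) (deriv (deriv g) t) t :=
    ((contDiffAt_deriv_right hg one_add_one_eq_two.le).differentiableAt one_ne_zero).hasDerivAt
  exact (((hderiv hf).mul (hderiv₂ hp)).sub ((hderiv₂ hf).mul (hderiv hp))).congr_deriv (by ring)

theorem integral_mul_deriv_deriv_sub_eq_zero (hp : ContDiff ℝ 2 p) (hpc : HasCompactSupport p)
    (hf : ∀ t ∈ tsupport p, ContDiffAt ℝ 2 f t) :
    ∫ t, (f t * deriv (deriv p) t - deriv (deriv f) t * p t) = 0 := by
  set W : ℝ → ℝ := fun t => f t * deriv p t - deriv f t * p t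
  have hzero {t : ℝ} (ht : t ∉ tsupport p) : W =ᶠ[𝓝 t] fun _ => 0 := by
    filter_upwards [(isClosed_tsupport p).isOpen_compl.mem_nhds ht] with s hs
    simp only [W, image_eq_zero_of_notMem_tsupport hs,
      image_eq_zero_of_notMem_tsupport (notMem_subset tsupport_deriv_subset hs), mul_zero, sub_zero]
  have hderiv_one {g : ℝ → ℝ} {t : ℝ} (hg : ContDiffAt ℝ 2 g t) : ContDiffAt ℝ 1 (deriv g) t :=
    contDiffAt_deriv_right hg one_add_one_eq_two.le
  have hW : ContDiff ℝ 1 W := contDiff_iff_contDiffAt.2 fun t => by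
    by_cases ht : t ∈ tsupport p
    · exact (((hf t ht).of_le one_le_two).mul (hderiv_one hp.contDiffAt)).sub
        ((hderiv_one (hf t ht)).mul (hp.contDiffAt.of_le one_le_two))
    · exact contDiffAt_const.congr_of_eventuallyEq (hzero ht)
  have hWc : HasCompactSupport W :=
    .intro hpc fun t ht => (hzero ht).eq_of_nhds
  have hderiv (t : ℝ) : deriv W t = f t * deriv (deriv p) t - deriv (deriv f) t * p t := by
    by_cases ht : t ∈ tsupport p
    · exact (hasDerivAt_mul_deriv_sub_deriv_mul (hf t ht) hp.contDiffAt).deriv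
    · rw [(hzero ht).deriv_eq, deriv_const, image_eq_zero_of_notMem_tsupport ht,
        image_eq_zero_of_notMem_tsupport (f := deriv (deriv p)) (notMem_subset
          (tsupport_deriv_subset.trans tsupport_deriv_subset) ht), mul_zero, mul_zero, sub_zero]
  simp_rw [← hderiv]
  exact integral_eq_zero_of_hasDerivAt_of_integrable
    (fun t => (hW.differentiable one_ne_zero t).hasDerivAt)
    ((hW.continuous_deriv le_rfl).integrable_of_hasCompactSupport hWc.deriv)
    (hW.continuous.integrable_of_hasCompactSupport hWc)

theorem lineDeriv_add_smul {F F' : Type*} [NormedAddCommGroup F] [NormedSpace ℝ F]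
    [NormedAddCommGroup F'] [NormedSpace ℝ F'] (u : F → F') (x e : F) (s : ℝ) :
    lineDeriv ℝ u (x + s • e) e = deriv (fun t : ℝ => u (x + t • e)) s := by
  have h := deriv_comp_const_add (fun t : ℝ => u (x + t • e)) s 0
  rw [add_zero] at h
  simp only [← h, lineDeriv, add_smul, add_assoc]

end Line

theorem integrable_mul_of_tsupport_subset {X : Type*} [TopologicalSpace X] [T2Space X]
    [MeasurableSpace X] [OpensMeasurableSpace X] {μ : Measure X} {u φ : X → ℝ} {Ω : Set X}
    (hu : LocallyIntegrableOn u Ω μ) (hφ : Continuous φ) (hφc : HasCompactSupport φ)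
    (hφΩ : tsupport φ ⊆ Ω) : Integrable (u * φ) μ := by
  have h : IntegrableOn (u * φ) (tsupport φ) μ :=
    (hu.integrableOn_compact_subset hφΩ hφc).mul_continuousOn hφ.continuousOn hφc
  exact (integrableOn_iff_integrable_of_support_subset
    ((support_mul_subset_right u φ).trans subset_closure)).1 h

section SecondPartial

variable {n : ℕ} {j : Fin n} {u φ : EuclideanSpace ℝ (Fin n) → ℝ} {x : EuclideanSpace ℝ (Fin n)}

theorem secondPartial_add_smul (s : ℝ) :
    secondPartial j u (x + s • EuclideanSpace.single j 1) =
      deriv (deriv fun t : ℝ => u (x + t • EuclideanSpace.single j 1)) s := by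
  rw [secondPartial, lineDeriv_add_smul]
  exact congrArg (deriv · s) (funext fun t => lineDeriv_add_smul u x _ t)

theorem secondPartial_eq_fderiv_fderiv (hu : ContDiffAt ℝ 2 u x) :
    secondPartial j u x = fderiv ℝ (fderiv ℝ u) x (.single j 1) (.single j 1) := by
  have hfirst : (fun y => lineDeriv ℝ u y (.single j 1)) =ᶠ[𝓝 x]
      fun y => fderiv ℝ u y (.single j 1) := by
    filter_upwards [hu.eventually (by simp)] with y hy
    exact (hy.differentiableAt two_ne_zero).lineDeriv_eq_fderiv
  have hsecond : DifferentiableAt ℝ (fderiv ℝ u) x :=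
    (hu.fderiv_right (m := 1) one_add_one_eq_two.le).differentiableAt one_ne_zero
  rw [secondPartial, hfirst.lineDeriv_eq,
    (hsecond.clm_apply (differentiableAt_const _)).lineDeriv_eq_fderiv,
    fderiv_clm_apply hsecond (differentiableAt_const _)]
  simp

theorem laplacian_eq_sum_secondPartial (hu : ContDiffAt ℝ 2 u x) :
    Δ u x = ∑ j, secondPartial j u x := by
  simp [laplacian_eq_sum_fderiv_fderiv (EuclideanSpace.basisFun (Fin n) ℝ),
    secondPartial_eq_fderiv_fderiv hu]

theorem continuous_secondPartial (hu : ContDiff ℝ 2 u) : Continuous (secondPartial j u) := by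
  have : Continuous (fderiv ℝ (fderiv ℝ u)) :=
    (hu.fderiv_right (m := 1) one_add_one_eq_two.le).continuous_fderiv one_ne_zero
  simp only [funext fun x => secondPartial_eq_fderiv_fderiv (j := j) (hu.contDiffAt (x := x))]
  fun_prop

theorem tsupport_secondPartial_subset : tsupport (secondPartial j u) ⊆ tsupport u := by
  refine closure_minimal (support_subset_iff'.2 fun x hx => ?_) (isClosed_tsupport u)
  have hzero : u =ᶠ[𝓝 x] fun _ => 0 := notMem_tsupport_iff_eventuallyEq.1 hx
  rw [secondPartial_eq_fderiv_fderiv (contDiffAt_const.congr_of_eventuallyEq hzero),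
    hzero.fderiv.fderiv_eq]
  simp

theorem integrable_mul_secondPartial {Ω : Set (EuclideanSpace ℝ (Fin n))}
    (hu : LocallyIntegrableOn u Ω) (hφ : ContDiff ℝ 2 φ) (hφc : HasCompactSupport φ)
    (hφΩ : tsupport φ ⊆ Ω) : Integrable (u * secondPartial j φ) :=
  integrable_mul_of_tsupport_subset hu (continuous_secondPartial hφ)
    (hφc.mono' (subset_closure.trans tsupport_secondPartial_subset))
    (tsupport_secondPartial_subset.trans hφΩ)

theorem integral_mul_secondPartial_sub_add_smul_eq_zero (hφ : ContDiff ℝ 2 φ)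
    (hφc : HasCompactSupport φ) (x : EuclideanSpace ℝ (Fin n))
    (hu : ∀ t : ℝ, x + t • EuclideanSpace.single j 1 ∈ tsupport φ →
      ContDiffAt ℝ 2 u (x + t • EuclideanSpace.single j 1)) :
    ∫ t : ℝ, (u * secondPartial j φ - secondPartial j u * φ)
      (x + t • EuclideanSpace.single j 1) = 0 := by
  set e : EuclideanSpace ℝ (Fin n) := EuclideanSpace.single j 1
  have hline : ContDiff ℝ 2 fun t : ℝ => x + t • e := by fun_prop
  have hembedding : Topology.IsClosedEmbedding fun t : ℝ => x + t • e :=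
    (Homeomorph.addLeft x).isClosedEmbedding.comp (isClosedEmbedding_smul_left (by simp [e]))
  simp only [Pi.sub_apply, Pi.mul_apply, secondPartial_add_smul, e]
  exact integral_mul_deriv_deriv_sub_eq_zero (hφ.comp hline) (hφc.comp_isClosedEmbedding hembedding)
    fun t ht => (hu t (tsupport_comp_subset_preimage φ hline.continuous ht)).comp t hline.contDiffAt

end SecondPartial

theorem ae_notMem_of_hausdorffMeasure_eq_zero {F : Type*} [NormedAddCommGroup F]
    [NormedSpace ℝ F] [FiniteDimensional ℝ F] [MeasurableSpace F] [BorelSpace F] (μ : Measure F)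
    [SigmaFinite μ] [μ.IsAddLeftInvariant] {d : ℝ} (hd : d ≤ Module.finrank ℝ F) {E : Set F}
    (hE : μH[d] E = 0) : ∀ᵐ x ∂μ, x ∉ E :=
  measure_eq_zero_iff_ae_notMem.1 (Measure.absolutelyContinuous_isAddHaarMeasure μ
    μH[Module.finrank ℝ F] (le_antisymm ((Measure.hausdorffMeasure_mono hd E).trans_eq hE) bot_le))

section InsertCoord

variable {m : ℕ}

/-- The identification of `ℝ × ℝᵐ` with `ℝᵐ⁺¹` that uses the first component as `j`-th coordinate,
which slices `ℝᵐ⁺¹` into lines parallel to the `j`-th axis. -/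
def insertCoord (j : Fin (m + 1)) : ℝ × (Fin m → ℝ) ≃ᵐ EuclideanSpace ℝ (Fin (m + 1)) :=
  (MeasurableEquiv.piFinSuccAbove (fun _ => ℝ) j).symm.trans (MeasurableEquiv.toLp 2 _)

theorem insertCoord_eq_add_smul (j : Fin (m + 1)) (t : ℝ) (z : Fin m → ℝ) :
    insertCoord j (t, z) = WithLp.toLp 2 (j.insertNth 0 z) + t • EuclideanSpace.single j 1 := by
  ext i
  refine j.succAboveCases ?_ (fun k => ?_) i <;> simp [insertCoord]

theorem measurePreserving_insertCoord (j : Fin (m + 1)) : MeasurePreserving (insertCoord j) :=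
  (PiLp.volume_preserving_toLp _).comp (volume_preserving_piFinSuccAbove (fun _ => ℝ) j).symm

theorem lipschitzWith_removeNth (j : Fin (m + 1)) :
    LipschitzWith 1 fun x : EuclideanSpace ℝ (Fin (m + 1)) => j.removeNth (α := fun _ => ℝ) x :=
  .of_edist_le fun x y => edist_pi_le_iff.2 fun k => (edist_le_pi_edist x.ofLp y.ofLp _).trans
    (by simpa using PiLp.lipschitzWith_ofLp 2 (fun _ => ℝ) x y)

theorem ae_forall_insertCoord_notMem (j : Fin (m + 1)) {E : Set (EuclideanSpace ℝ (Fin (m + 1)))}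
    (hE : μH[(m : ℝ)] E = 0) : ∀ᵐ z : Fin m → ℝ, ∀ t : ℝ, insertCoord j (t, z) ∉ E := by
  have hprojection : volume ((fun x => j.removeNth (α := fun _ => ℝ) x.ofLp) '' E) = 0 := by
    have h := (lipschitzWith_removeNth j).hausdorffMeasure_image_le m.cast_nonneg E
    rw [hE, mul_zero, nonpos_iff_eq_zero] at h
    rwa [← hausdorffMeasure_pi_real, Fintype.card_fin]
  filter_upwards [measure_eq_zero_iff_ae_notMem.1 hprojection] with z hz t ht
  exact hz ⟨_, ht, Fin.removeNth_insertNth (α := fun _ => ℝ) j t z⟩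

end InsertCoord

section WeaklyHarmonic

variable {m : ℕ} {Ω E : Set (EuclideanSpace ℝ (Fin (m + 1)))}
  {u φ : EuclideanSpace ℝ (Fin (m + 1)) → ℝ}

theorem integral_mul_secondPartial_eq_integral_secondPartial_mul {j : Fin (m + 1)}
    (hu : LocallyIntegrableOn u Ω) (hu₂ : LocallyIntegrableOn (secondPartial j u) Ω)
    (hline : ∀ᵐ z, ∀ t : ℝ, insertCoord j (t, z) ∈ Ω → ContDiffAt ℝ 2 u (insertCoord j (t, z)))
    (hφ : ContDiff ℝ 2 φ) (hφc : HasCompactSupport φ) (hφΩ : tsupport φ ⊆ Ω) :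
    ∫ x, (u * secondPartial j φ) x = ∫ x, (secondPartial j u * φ) x := by
  have hint : Integrable (u * secondPartial j φ) :=
    integrable_mul_secondPartial hu hφ hφc hφΩ
  have hint₂ : Integrable (secondPartial j u * φ) :=
    integrable_mul_of_tsupport_subset hu₂ hφ.continuous hφc hφΩ
  have hpreserving := measurePreserving_insertCoord j
  rw [← sub_eq_zero, ← integral_sub' hint hint₂, ← hpreserving.integral_comp',
    Measure.volume_eq_prod]
  refine (integral_prod_symm _ ((hpreserving.integrable_comp_emb
    (insertCoord j).measurableEmbedding).2 (hint.sub hint₂))).trans (integral_eq_zero_of_ae ?_)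
  filter_upwards [hline] with z hz
  simp only [comp_apply, insertCoord_eq_add_smul, Pi.zero_apply] at hz ⊢
  exact integral_mul_secondPartial_sub_add_smul_eq_zero hφ hφc _ fun t ht => hz t (hφΩ ht)

theorem isWeaklyHarmonicOn_of_harmonicOnNhd_diff (hE : μH[(m : ℝ)] E = 0)
    (hu : HarmonicOnNhd u (Ω \ E)) (hu_int : LocallyIntegrableOn u Ω)
    (hu_int₂ : ∀ j, LocallyIntegrableOn (secondPartial j u) Ω) :
    IsWeaklyHarmonicOn u Ω volume where
  locallyIntegrableOn := hu_int
  integral_mul_laplacian_eq_zero φ hφ hφc hφΩ := by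
    have hφ₂ : ContDiff ℝ 2 φ := contDiff_infty.1 hφ 2
    have hparts (j) : ∫ x, (u * secondPartial j φ) x = ∫ x, (secondPartial j u * φ) x := by
      refine integral_mul_secondPartial_eq_integral_secondPartial_mul hu_int (hu_int₂ j) ?_
        hφ₂ hφc hφΩ
      filter_upwards [ae_forall_insertCoord_notMem j hE] with z hz t ht using (hu _ ⟨ht, hz t⟩).1
    calc ∫ x, u x * Δ φ x
      _ = ∫ x, ∑ j, (u * secondPartial j φ) x := by
        simp only [laplacian_eq_sum_secondPartial hφ₂.contDiffAt, Pi.mul_apply, Finset.mul_sum]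
      _ = ∑ j, ∫ x, (u * secondPartial j φ) x :=
        integral_finsetSum _ fun j _ => integrable_mul_secondPartial hu_int hφ₂ hφc hφΩ
      _ = ∑ j, ∫ x, (secondPartial j u * φ) x := Finset.sum_congr rfl fun j _ => hparts j
      _ = ∫ x, ∑ j, (secondPartial j u * φ) x :=
        (integral_finsetSum _ fun j _ =>
          integrable_mul_of_tsupport_subset (hu_int₂ j) hφ.continuous hφc hφΩ).symm
      _ = 0 := integral_eq_zero_of_ae ?_
    filter_upwards [ae_notMem_of_hausdorffMeasure_eq_zero volume (by simp) hE] with x hxE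
    by_cases hxΩ : x ∈ Ω
    · have hx := hu x ⟨hxΩ, hxE⟩
      simp only [Pi.mul_apply, ← Finset.sum_mul, ← laplacian_eq_sum_secondPartial hx.1,
        hx.2.eq_of_nhds, Pi.zero_apply, zero_mul]
    · simp only [Pi.mul_apply, image_eq_zero_of_notMem_tsupport (notMem_subset hφΩ hxΩ), mul_zero,
        Finset.sum_const_zero, Pi.zero_apply]

end WeaklyHarmonic

theorem corollary5_general (m : ℕ) (Ω E : Set (EuclideanSpace ℝ (Fin (m + 1)))) (hΩ : IsOpen Ω)
    (hE : μH[(m : ℝ)] E = 0) (u : EuclideanSpace ℝ (Fin (m + 1)) → ℝ)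
    (hu : HarmonicOnNhd u (Ω \ E)) (hu_int : LocallyIntegrableOn u Ω volume)
    (hu_int₂ : ∀ j, LocallyIntegrableOn (secondPartial j u) Ω volume) :
    ∃ v : EuclideanSpace ℝ (Fin (m + 1)) → ℝ, (HarmonicOnNhd v Ω ∧ EqOn v u (Ω \ E)) ∧
      ∀ w : EuclideanSpace ℝ (Fin (m + 1)) → ℝ,
        HarmonicOnNhd w Ω → EqOn w u (Ω \ E) → EqOn w v Ω := by
  obtain ⟨v, hv, hvu⟩ :=
    (isWeaklyHarmonicOn_of_harmonicOnNhd_diff hE hu hu_int hu_int₂).exists_harmonicOnNhd_ae_eq hΩ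
  refine ⟨v, ⟨hv, fun x hx => ?_⟩, fun w hw hwu => ?_⟩
  · have hopen : IsOpen (Ω ∩ {x | HarmonicAt u x}) := hΩ.inter (isOpen_setOfPred_harmonicAt u)
    exact eqOn_of_harmonicOnNhd_of_ae_eq hopen (hv.mono inter_subset_left) (fun y hy => hy.2)
      (ae_restrict_of_ae_restrict_of_subset inter_subset_left hvu) ⟨hx.1, hu x hx⟩
  · refine eqOn_of_harmonicOnNhd_of_ae_eq (μ := volume) hΩ hw hv (EventuallyEq.trans ?_ hvu.symm)
    filter_upwards [ae_restrict_mem hΩ.measurableSet,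
      ae_restrict_of_ae (ae_notMem_of_hausdorffMeasure_eq_zero volume (by simp) hE)] with x hx hxE
    exact hwu ⟨hx, hxE⟩

/-- `u` is a total function, but only its values on the open set `Ω \ E` matter: `E` is a null set,
so neither its values nor its derivatives on `E` influence local integrability on `Ω`. -/
theorem corollary5 (n : ℕ) (hn : 2 ≤ n)
    (Ω E : Set (EuclideanSpace ℝ (Fin n)))
    (hΩ_open : IsOpen Ω) (hΩ_conn : IsConnected Ω)
    (hE_sub : E ⊆ Ω) (hE_closed : IsClosed ((↑) ⁻¹' E : Set Ω))
    (hE_null : μH[(n : ℝ) - 1] E = 0)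
    (u : EuclideanSpace ℝ (Fin n) → ℝ)
    (hu : InnerProductSpace.HarmonicOnNhd u (Ω \ E))
    (hu_int : LocallyIntegrableOn u Ω volume)
    (hu_int₂ : ∀ j : Fin n, LocallyIntegrableOn (secondPartial j u) Ω volume) :
    ∃ v : EuclideanSpace ℝ (Fin n) → ℝ,
      (InnerProductSpace.HarmonicOnNhd v Ω ∧ Set.EqOn v u (Ω \ E)) ∧
      ∀ w : EuclideanSpace ℝ (Fin n) → ℝ,
        InnerProductSpace.HarmonicOnNhd w Ω → Set.EqOn w u (Ω \ E) → Set.EqOn w v Ω := by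
  obtain ⟨m, rfl⟩ : ∃ m, n = m + 1 := Nat.exists_eq_add_one.2 (two_pos.trans_le hn)
  exact corollary5_general m Ω E hΩ_open (by simpa using hE_null) u hu hu_int hu_int₂
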